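/- Let $U_\infty$ denote the full unitary group of the separable complex Hilbert space $\ell_2$, equipped with the strong operator topology. For every abelian Polish group $G$ there exist a closed abelian subgroup $H$ of $U_\infty$ and a closed normal subgroup $N$ of $H$ such that $G$ is isomorphic, as a topological group, to the factor-group $H/N$ with the quotient topology. -/

import Mathlib

/-- The separable complex Hilbert space `ℓ₂` of square-summable complex sequences. -/
abbrev HilbertEllTwo : Type := lp (fun _ : ℕ => ℂ) 2

/-- The full unitary group of `ℓ₂`: its underlying set consists of the unitary operators, that is,
the surjective complex-linear isometries of `ℓ₂` onto itself. -/
def FullUnitaryGroup : Type := HilbertEllTwo ≃ₗᵢ[ℂ] HilbertEllTwo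

namespace FullUnitaryGroup

/-- The group operation is composition of operators. -/
noncomputable instance instGroup : Group FullUnitaryGroup :=
  inferInstanceAs (Group (HilbertEllTwo ≃ₗᵢ[ℂ] HilbertEllTwo))

/-- An element of the full unitary group, regarded as an isometric linear bijection. -/
def toIsometry (u : FullUnitaryGroup) : HilbertEllTwo ≃ₗᵢ[ℂ] HilbertEllTwo := u

/-- The action of a unitary operator on vectors. -/
noncomputable def toFun (u : FullUnitaryGroup) (x : HilbertEllTwo) : HilbertEllTwo :=
  u.toIsometry x

/-- The strong operator topology: the coarsest topology for which `u ↦ u x` is continuous into the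
norm topology of `ℓ₂`, for every vector `x`. -/
noncomputable instance instTopologicalSpace : TopologicalSpace FullUnitaryGroup :=
  ⨅ x : HilbertEllTwo, TopologicalSpace.induced (fun u => u.toFun x) inferInstance

theorem continuous_iff {X : Type*} [TopologicalSpace X] {f : X → FullUnitaryGroup} :
    Continuous f ↔ ∀ x, Continuous fun a => (f a).toFun x := by
  rw [continuous_iInf_rng]
  exact forall_congr' fun x => continuous_induced_rng

theorem continuous_toFun (x : HilbertEllTwo) :
    Continuous fun u : FullUnitaryGroup => u.toFun x :=
  continuous_iff.1 continuous_id x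

theorem dist_toFun (u : FullUnitaryGroup) (x y : HilbertEllTwo) :
    dist (u.toFun x) (u.toFun y) = dist x y :=
  LinearIsometryEquiv.dist_map u.toIsometry x y

theorem mul_toFun (u v : FullUnitaryGroup) (x : HilbertEllTwo) :
    (u * v).toFun x = u.toFun (v.toFun x) := rfl

theorem toFun_inv_toFun (u : FullUnitaryGroup) (x : HilbertEllTwo) :
    u.toFun (u⁻¹.toFun x) = x :=
  LinearIsometryEquiv.apply_symm_apply u.toIsometry x

instance instIsTopologicalGroup : IsTopologicalGroup FullUnitaryGroup where
  continuous_mul := by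
    refine continuous_iff.2 fun x => continuous_iff_continuousAt.2 fun p => ?_
    have h : Filter.Tendsto (fun q : FullUnitaryGroup × FullUnitaryGroup =>
        dist (q.2.toFun x) (p.2.toFun x) + dist (q.1.toFun (p.2.toFun x)) (p.1.toFun (p.2.toFun x)))
        (nhds p) (nhds 0) := by
      have hc : Continuous (fun q : FullUnitaryGroup × FullUnitaryGroup =>
          dist (q.2.toFun x) (p.2.toFun x) +
            dist (q.1.toFun (p.2.toFun x)) (p.1.toFun (p.2.toFun x))) :=
        (((continuous_toFun x).comp continuous_snd).dist continuous_const).add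
          (((continuous_toFun (p.2.toFun x)).comp continuous_fst).dist continuous_const)
      simpa using hc.tendsto p
    refine tendsto_iff_dist_tendsto_zero.2 (squeeze_zero (fun _ => dist_nonneg) (fun q => ?_) h)
    simp only [mul_toFun]
    refine (dist_triangle _ (q.1.toFun (p.2.toFun x)) _).trans ?_
    rw [dist_toFun]
  continuous_inv := by
    refine continuous_iff.2 fun x => continuous_iff_continuousAt.2 fun v => ?_
    have h : Filter.Tendsto (fun u : FullUnitaryGroup => dist (u.toFun (v⁻¹.toFun x)) x)
        (nhds v) (nhds 0) := by
      have hc : Continuous (fun u : FullUnitaryGroup => dist (u.toFun (v⁻¹.toFun x)) x) :=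
        (continuous_toFun (v⁻¹.toFun x)).dist continuous_const
      simpa [toFun_inv_toFun] using hc.tendsto v
    refine tendsto_iff_dist_tendsto_zero.2 (squeeze_zero (fun _ => dist_nonneg) (fun u => ?_) h)
    rw [← dist_toFun u, toFun_inv_toFun, dist_comm]

end FullUnitaryGroup

/-!
Every abelian Polish group `G` is a quotient of a closed subgroup of a separable real Hilbert space,
and the additive group of such a Hilbert space is a closed subgroup of the full unitary group.

*From `G` to a Hilbert space.* The topology of `G`, written additively, comes from a
translation-invariant metric, that is, from a group norm, which is complete by a Baire category
argument (`exists_complete_addGroupNorm`). Let `D` be a countable dense subgroup. In `ℓ²(D)`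
consider the closed subgroup `weightedLattice D` of the points with coordinates `n d * √‖d‖`, where
the `n d` are integers. Since `|n| ≤ n ^ 2` for integers, `∑ d, ‖n d • d‖` is at most the squared norm
of such a point, so `∑ d, n d • d` converges in `G` and defines a continuous homomorphism
`weightedLattice.eval`. It is open and onto because each `a : G` is a rapidly convergent series of
elements of `D` with sizes controlled by `‖a‖` (`weightedLattice.exists_eval_eq`).

*From a Hilbert space to unitary operators.* For a real Hilbert space `E` the kernel
`exp (-‖x - y‖² / 2)` is positive semidefinite by the Schur product theorem
(`posSemidef_gaussianKernel`). So there are vectors `e x` spanning a dense subspace of a complex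
Hilbert space with this Gram matrix, and the translations of `E` act on that space by unitary
operators `e x ↦ e (x + y)`. As `‖e x - e y‖` depends only on `‖x - y‖` and is small exactly when
`‖x - y‖` is, this representation is a closed topological embedding
(`FullUnitaryGroup.exists_isClosedEmbedding`).
-/

open Filter Topology Set
open scoped InnerProductSpace Matrix

universe u

/-! ### Complete invariant metrics on abelian Polish groups -/

/-- A densely and topologically embedded completely metrizable space is a `Gδ` subset: the image is
the set of points having neighbourhoods whose traces have arbitrarily small diameter for a complete
metric of the source. -/
theorem Topology.IsDenseInducing.isGδ_range {X Y : Type*} [TopologicalSpace X]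
    [TopologicalSpace.IsCompletelyMetrizableSpace X] [TopologicalSpace Y] [T2Space Y] {f : X → Y}
    (hf : IsDenseInducing f) : IsGδ (range f) := by
  let _ := TopologicalSpace.upgradeIsCompletelyMetrizable X
  let W : ℕ → Set Y := fun n =>
    ⋃₀ {O | IsOpen O ∧ ∀ a b, f a ∈ O → f b ∈ O → dist a b < 1 / ((n : ℝ) + 1)}
  have hW : range f = ⋂ n, W n := by
    apply Subset.antisymm
    · rintro _ ⟨a, rfl⟩
      refine mem_iInter.2 fun n => ?_
      have hpos : (0 : ℝ) < 1 / ((n : ℝ) + 1) / 2 := by positivity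
      obtain ⟨O, hO, hOa⟩ := hf.isInducing.isOpen_iff.1
        (Metric.isOpen_ball (x := a) (ε := 1 / ((n : ℝ) + 1) / 2))
      refine mem_sUnion.2 ⟨O, ⟨hO, fun b c hb hc => ?_⟩, ?_⟩
      · have hb' : b ∈ Metric.ball a (1 / ((n : ℝ) + 1) / 2) := hOa ▸ hb
        have hc' : c ∈ Metric.ball a (1 / ((n : ℝ) + 1) / 2) := hOa ▸ hc
        have := dist_triangle_right b c a
        rw [Metric.mem_ball] at hb' hc'
        linarith
      · have : a ∈ f ⁻¹' O := hOa ▸ Metric.mem_ball_self hpos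
        exact this
    · -- The trace of `𝓝 y` is Cauchy for the complete metric, and its limit is a preimage of `y`.
      intro y hy
      have hne : (comap f (𝓝 y)).NeBot := hf.comap_nhds_neBot y
      have hc : Cauchy (comap f (𝓝 y)) := by
        refine Metric.cauchy_iff.2 ⟨hne, fun ε hε => ?_⟩
        obtain ⟨n, hn⟩ := exists_nat_one_div_lt hε
        obtain ⟨O, ⟨hO, hOd⟩, hyO⟩ := mem_sUnion.1 (mem_iInter.1 hy n)
        exact ⟨f ⁻¹' O, preimage_mem_comap (hO.mem_nhds hyO),
          fun a ha b hb => (hOd a b ha hb).trans hn⟩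
      obtain ⟨a, ha⟩ := CompleteSpace.complete hc
      exact ⟨a, tendsto_nhds_unique ((hf.continuous.tendsto a).mono_left ha) tendsto_comap⟩
  rw [hW]
  exact IsGδ.iInter_of_isOpen fun n => isOpen_sUnion fun O hO => hO.1

/-- If some metric for the topology of a normed group is complete, then so is the given norm. In the
completion, the group and any of its translates are dense `Gδ` sets, so they meet by Baire's
theorem; hence the group is the whole completion. -/
theorem NormedAddCommGroup.completeSpace_of_isCompletelyMetrizableSpace (A : Type*)
    [NormedAddCommGroup A] [TopologicalSpace.IsCompletelyMetrizableSpace A] : CompleteSpace A := by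
  have hd : Dense (range ((↑) : A → UniformSpace.Completion A)) :=
    UniformSpace.Completion.denseRange_coe
  have hG : IsGδ (range ((↑) : A → UniformSpace.Completion A)) :=
    UniformSpace.Completion.isDenseInducing_coe.isGδ_range
  refine (UniformSpace.Completion.isUniformInducing_coe A).completeSpace_congr ?_ |>.2 inferInstance
  intro z
  let τ := Homeomorph.addLeft z
  have hG' : IsGδ (τ ⁻¹' range ((↑) : A → UniformSpace.Completion A)) := hG.preimage τ.continuous
  have hd' : Dense (τ ⁻¹' range ((↑) : A → UniformSpace.Completion A)) :=
    hd.preimage τ.isOpenMap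
  obtain ⟨_, ⟨a, rfl⟩, b, hb⟩ := (hd.inter_of_Gδ hG hG' hd').nonempty
  refine ⟨b - a, ?_⟩
  have hb' : (b : UniformSpace.Completion A) = z + a := hb
  rw [UniformSpace.Completion.coe_sub, hb', add_sub_cancel_right]

/-- An abelian topological group which is Hausdorff and first countable has a translation-invariant
compatible metric, here in the form of a group norm. Starting from any metric `d` for the group
uniformity, the norm is `N a = sup_g min 1 (d (a + g) g)`; it still tends to `0` with `a` because
the group uniformity is translation invariant. -/
theorem exists_addGroupNorm (G : Type*) [AddCommGroup G] [TopologicalSpace G]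
    [IsTopologicalAddGroup G] [T2Space G] [FirstCountableTopology G] :
    ∃ N : AddGroupNorm G, (𝓝 (0 : G)).HasBasis (fun ε : ℝ => 0 < ε) fun ε => {a | N a < ε} := by
  let _ : UniformSpace G := IsTopologicalAddGroup.rightUniformSpace G
  have : IsUniformAddGroup G := isUniformAddGroup_of_addCommGroup
  have : (uniformity G).IsCountablyGenerated := IsUniformAddGroup.uniformity_countably_generated
  let _ : MetricSpace G := UniformSpace.metricSpace G
  let N : G → ℝ := fun a => ⨆ g : G, min 1 (dist (a + g) g)
  have hbdd (a : G) : BddAbove (range fun g : G => min 1 (dist (a + g) g)) :=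
    ⟨1, by rintro _ ⟨g, rfl⟩; exact min_le_left _ _⟩
  have hle (a g : G) : min 1 (dist (a + g) g) ≤ N a := le_ciSup (hbdd a) g
  have hnonneg (a : G) : 0 ≤ N a := le_trans (by positivity) (hle a 0)
  have hneg (a : G) : N (-a) ≤ N a := by
    refine ciSup_le fun g => ?_
    have := hle a (-a + g)
    rwa [add_neg_cancel_left, dist_comm] at this
  let M : AddGroupNorm G :=
    { toFun := N
      map_zero' := by simp [N]
      add_le' := fun a b => ciSup_le fun g => by
        have h1 := hle a (b + g)
        have h2 := hle b g
        have h3 := dist_triangle (a + b + g) (b + g) g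
        have h4 : (0 : ℝ) ≤ dist (a + (b + g)) (b + g) := dist_nonneg
        have h5 : (0 : ℝ) ≤ dist (b + g) g := dist_nonneg
        rw [← add_assoc] at h1 h4
        refine le_trans ?_ (add_le_add h1 h2)
        grind
      neg' := fun a => (hneg a).antisymm (by simpa using hneg (-a))
      eq_zero_of_map_eq_zero' := fun a (ha : N a = 0) => by
        have h1 := hle a 0
        have h2 : (0 : ℝ) ≤ dist (a + 0) 0 := dist_nonneg
        rw [ha] at h1
        have : dist (a + 0) 0 = 0 := by grind
        simpa using this }
  refine ⟨M, ⟨fun s => ⟨fun hs => ?_, ?_⟩⟩⟩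
  · obtain ⟨ε, hε, hs⟩ := Metric.mem_nhds_iff.1 hs
    refine ⟨min 1 ε, by positivity, fun a (ha : N a < _) => hs ?_⟩
    have h1 := hle a 0
    rw [add_zero] at h1
    rw [Metric.mem_ball]
    grind
  · rintro ⟨ε, hε, hs⟩
    have hu : {p : G × G | dist p.1 p.2 < ε / 2} ∈ uniformity G :=
      Metric.dist_mem_uniformity (half_pos hε)
    rw [uniformity_eq_comap_nhds_zero' G] at hu
    obtain ⟨V, hV, hVs⟩ := hu
    filter_upwards [hV] with a ha
    refine hs ((ciSup_le fun g => ?_).trans_lt (half_lt_self hε))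
    have : dist g (a + g) < ε / 2 := @hVs (g, a + g) (by simpa using ha)
    rw [dist_comm] at this
    exact (min_le_right _ _).trans this.le

/-- A completely metrizable abelian topological group is a complete normed group for some group
norm. -/
theorem exists_complete_addGroupNorm (G : Type*) [AddCommGroup G] [t : TopologicalSpace G]
    [IsTopologicalAddGroup G] [TopologicalSpace.IsCompletelyMetrizableSpace G] :
    ∃ N : AddGroupNorm G,
      t = N.toNormedAddCommGroup.toMetricSpace.toUniformSpace.toTopologicalSpace ∧
      @CompleteSpace G N.toNormedAddCommGroup.toMetricSpace.toUniformSpace := by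
  obtain ⟨N, hN⟩ := exists_addGroupNorm G
  have ht : t = N.toNormedAddCommGroup.toMetricSpace.toUniformSpace.toTopologicalSpace := by
    let _ := N.toNormedAddCommGroup
    refine IsTopologicalAddGroup.ext inferInstance inferInstance ?_
    refine hN.eq_of_same_basis ?_
    convert Metric.nhds_basis_ball (x := (0 : G)) using 2 with ε
    ext a
    simp only [Metric.mem_ball, dist_zero_right]
    rfl
  subst ht
  let _ := N.toNormedAddCommGroup
  exact ⟨N, rfl, NormedAddCommGroup.completeSpace_of_isCompletelyMetrizableSpace G⟩

/-! ### Quotients of weighted integer lattices in Hilbert space -/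

theorem lp.hasSum_norm_sq {ι : Type*} (y : lp (fun _ : ι => ℝ) 2) :
    HasSum (fun i => ‖y i‖ ^ 2) (‖y‖ ^ 2) := by
  simpa using lp.hasSum_norm (p := 2) (by norm_num) y

section Lattice

variable {A : Type*} [NormedAddCommGroup A]

/-- The subgroup of the real Hilbert space `ℓ²(D)` of all `y` whose coordinate at each `d ∈ D` is an
integer multiple of `√‖d‖`. The coordinate at `d = 0` is forced to vanish. -/
def weightedLattice (D : AddSubgroup A) : AddSubgroup (lp (fun _ : D => ℝ) 2) where
  carrier := {y | ∀ d : D, ∃ n : ℤ, y d = n * √‖(d : A)‖}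
  zero_mem' _ := ⟨0, by simp⟩
  add_mem' {y z} hy hz d := by
    obtain ⟨m, hm⟩ := hy d
    obtain ⟨n, hn⟩ := hz d
    exact ⟨m + n, by simp [hm, hn, add_mul]⟩
  neg_mem' {y} hy d := by
    obtain ⟨m, hm⟩ := hy d
    exact ⟨-m, by simp [hm]⟩

namespace weightedLattice

variable {D : AddSubgroup A}

theorem isClosed : IsClosed (weightedLattice D : Set (lp (fun _ : D => ℝ) 2)) := by
  have : (weightedLattice D : Set (lp (fun _ : D => ℝ) 2)) =
      ⋂ d : D, (fun y : lp (fun _ : D => ℝ) 2 => y d) ⁻¹'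
        range fun n : ℤ => (n : ℝ) * √‖(d : A)‖ := by
    ext y
    simp [weightedLattice, eq_comm]
  rw [this]
  refine isClosed_iInter fun d => IsClosed.preimage ?_ ?_
  · exact (continuous_apply d).comp lp.uniformContinuous_coe.continuous
  · rcases eq_or_ne √‖(d : A)‖ 0 with h | h
    · simp [h]
    · have := (Homeomorph.mulRight₀ _ h).isClosedEmbedding.comp Int.isClosedEmbedding_coe_real
      exact this.isClosed_range

instance : CompleteSpace (weightedLattice D) := isClosed.completeSpace_coe

/-- The integer `n` with `y d = n * √‖d‖`. For `d = 0` this is `0`, by the conventions for division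
by zero. -/
noncomputable def coeff (y : weightedLattice D) (d : D) : ℤ :=
  round ((y : lp (fun _ : D => ℝ) 2) d / √‖(d : A)‖)

theorem coeff_zsmul {y : weightedLattice D} {d : D} {n : ℤ}
    (h : (y : lp (fun _ : D => ℝ) 2) d = n * √‖(d : A)‖) :
    coeff y d • (d : A) = n • (d : A) := by
  rcases eq_or_ne (d : A) 0 with hd | hd
  · simp [hd]
  · have : √‖(d : A)‖ ≠ 0 := (Real.sqrt_pos.2 (norm_pos_iff.2 hd)).ne'
    rw [coeff, h, mul_div_cancel_right₀ _ this, round_intCast]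

/-- An integer `n` satisfies `|n| ≤ n ^ 2`, so the norm of `n • d` is at most `n ^ 2 * ‖d‖`, which is
the square of the coordinate `n * √‖d‖`. -/
theorem norm_coeff_zsmul_le (y : weightedLattice D) (d : D) :
    ‖coeff y d • (d : A)‖ ≤ ‖(y : lp (fun _ : D => ℝ) 2) d‖ ^ 2 := by
  obtain ⟨n, hn⟩ := y.2 d
  have hn1 : |(n : ℝ)| ≤ (n : ℝ) ^ 2 := by
    rw [← Int.cast_abs]
    exact_mod_cast (Int.natCast_natAbs n ▸ Int.natAbs_le_self_sq n : |n| ≤ n ^ 2)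
  calc ‖coeff y d • (d : A)‖ = ‖n • (d : A)‖ := by rw [coeff_zsmul hn]
    _ ≤ ‖n‖ * ‖(d : A)‖ := norm_zsmul_le _ _
    _ ≤ (n : ℝ) ^ 2 * ‖(d : A)‖ := by
      gcongr
      rwa [Int.norm_eq_abs]
    _ = ‖(y : lp (fun _ : D => ℝ) 2) d‖ ^ 2 := by
      rw [hn, norm_mul, mul_pow, Real.norm_eq_abs, Real.norm_eq_abs, sq_abs, sq_abs,
        Real.sq_sqrt (norm_nonneg _)]

theorem summable_norm_coeff_zsmul (y : weightedLattice D) :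
    Summable fun d : D => ‖coeff y d • (d : A)‖ :=
  .of_nonneg_of_le (fun _ => norm_nonneg _) (norm_coeff_zsmul_le y) (lp.hasSum_norm_sq y.1).summable

variable [CompleteSpace A]

variable (D) in
/-- The homomorphism sending the lattice point with coordinates `n d * √‖d‖` to the sum
`∑ d, n d • d`. -/
noncomputable def eval : weightedLattice D →+ A where
  toFun y := ∑' d : D, coeff y d • (d : A)
  map_zero' := by simp [coeff]
  map_add' y z := by
    rw [← (summable_norm_coeff_zsmul y).of_norm.tsum_add (summable_norm_coeff_zsmul z).of_norm]
    refine tsum_congr fun d => ?_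
    obtain ⟨m, hm⟩ := y.2 d
    obtain ⟨n, hn⟩ := z.2 d
    rw [coeff_zsmul hm, coeff_zsmul hn, ← add_zsmul]
    exact coeff_zsmul (by simp [hm, hn, add_mul])

theorem norm_eval_le (y : weightedLattice D) : ‖eval D y‖ ≤ ‖y‖ ^ 2 :=
  (norm_tsum_le_tsum_norm (summable_norm_coeff_zsmul y)).trans <|
    ((summable_norm_coeff_zsmul y).tsum_le_tsum (norm_coeff_zsmul_le y)
      (lp.hasSum_norm_sq y.1).summable).trans_eq (lp.hasSum_norm_sq y.1).tsum_eq

theorem continuous_eval : Continuous (eval D) := by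
  refine continuous_of_continuousAt_zero _ ?_
  rw [ContinuousAt, map_zero]
  refine squeeze_zero_norm norm_eval_le ?_
  have : Continuous fun y : weightedLattice D => ‖y‖ ^ 2 := by fun_prop
  simpa using this.tendsto 0

theorem exists_eval_eq_coe (d : D) :
    ∃ y : weightedLattice D, eval D y = d ∧ ‖y‖ = √‖(d : A)‖ := by
  classical
  let y : lp (fun _ : D => ℝ) 2 := lp.single 2 d √‖(d : A)‖
  have hd : y d = (1 : ℤ) * √‖(d : A)‖ := by simp [y]
  have hne : ∀ d' ≠ d, y d' = (0 : ℤ) * √‖(d' : A)‖ := fun d' h => by simp [y, h]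
  have hy : y ∈ weightedLattice D := fun d' => by
    rcases eq_or_ne d' d with rfl | h
    · exact ⟨1, hd⟩
    · exact ⟨0, hne d' h⟩
  refine ⟨⟨y, hy⟩, ?_, ?_⟩
  · refine (tsum_eq_single d fun d' h => ?_).trans ?_
    · rw [coeff_zsmul (hne d' h), zero_zsmul]
    · rw [coeff_zsmul hd, one_zsmul]
  · change ‖y‖ = _
    simp [y]

/-- Every `a` is a sum of elements of `D` with norms decreasing geometrically from a multiple of
`‖a‖`; lifting the terms to generators of the lattice gives a preimage of `a` which is small when
`a` is. -/
theorem exists_eval_eq (hD : Dense (D : Set A)) (a : A) :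
    ∃ y : weightedLattice D, eval D y = a ∧ ‖y‖ ≤ 2 * √(2 * ‖a‖) := by
  rcases eq_or_ne a 0 with rfl | ha
  · exact ⟨0, by simp⟩
  have hr : 0 < ‖a‖ := norm_pos_iff.2 ha
  obtain ⟨v, hv, hvD, hv0, hvn⟩ := controlled_sum_of_mem_closure (hD a)
    (b := fun n => ‖a‖ * (1 / 4) ^ n) (fun n => by positivity)
  have hbound (n : ℕ) : ‖v n‖ ≤ 2 * ‖a‖ * (1 / 4) ^ n := by
    rcases Nat.eq_zero_or_pos n with rfl | hn
    · have := norm_sub_le a (-v 0 + a)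
      rw [neg_add_eq_sub, sub_sub_cancel] at this
      rw [neg_add_eq_sub] at hv0
      simp only [pow_zero, mul_one] at hv0 ⊢
      linarith
    · refine (hvn n hn).le.trans ?_
      gcongr
      linarith
  choose y hy hny using fun n => exists_eval_eq_coe (⟨v n, hvD n⟩ : D)
  have hgeom : HasSum (fun n : ℕ => √(2 * ‖a‖) * (1 / 2 : ℝ) ^ n) (√(2 * ‖a‖) * 2) :=
    hasSum_geometric_two.mul_left _
  have hle (n : ℕ) : ‖y n‖ ≤ √(2 * ‖a‖) * (1 / 2) ^ n := by
    rw [hny n]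
    refine (Real.sqrt_le_sqrt (hbound n)).trans_eq ?_
    rw [Real.sqrt_mul (by positivity)]
    congr 1
    rw [Real.sqrt_eq_iff_mul_self_eq (by positivity) (by positivity), ← mul_pow]
    norm_num
  have hsum : Summable y := .of_norm_bounded hgeom.summable hle
  refine ⟨∑' n, y n, ?_, ?_⟩
  · have h1 := (hsum.hasSum.map (eval D) continuous_eval).tendsto_sum_nat
    refine tendsto_nhds_unique (h1.comp (tendsto_add_atTop_nat 1)) ?_
    simpa [Function.comp_def, hy] using hv
  · rw [mul_comm]
    exact tsum_of_norm_bounded hgeom hle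

theorem isOpenQuotientMap_eval (hD : Dense (D : Set A)) : IsOpenQuotientMap (eval D) where
  surjective a := (exists_eval_eq hD a).imp fun _ h => h.1
  continuous := continuous_eval
  isOpenMap := by
    rw [IsTopologicalAddGroup.isOpenMap_iff_nhds_zero]
    intro s hs
    obtain ⟨ε, hε, hs⟩ := Metric.mem_nhds_iff.1 (mem_map.1 hs)
    have : Continuous fun a : A => 2 * √(2 * ‖a‖) := by fun_prop
    have h0 : ∀ᶠ a in 𝓝 (0 : A), 2 * √(2 * ‖a‖) < ε :=
      this.continuousAt.eventually_lt_const (by simpa)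
    filter_upwards [h0] with a ha
    obtain ⟨y, rfl, hy⟩ := exists_eval_eq hD a
    exact hs (mem_ball_zero_iff.2 (hy.trans_lt ha))

end weightedLattice

end Lattice

/-! ### Positive semidefiniteness of the Gaussian kernel -/

section Kernel

variable {E : Type*} [NormedAddCommGroup E] [InnerProductSpace ℝ E]

theorem Matrix.PosSemidef.of_tendsto {ι : Type*} {M : ℕ → Matrix ι ι ℝ} {M' : Matrix ι ι ℝ}
    (hM : ∀ n, (M n).PosSemidef) (h : ∀ i j, Tendsto (fun n => M n i j) atTop (𝓝 (M' i j))) :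
    M'.PosSemidef := by
  refine ⟨Matrix.IsHermitian.ext fun i j => ?_, fun x => ?_⟩
  · refine tendsto_nhds_unique (h j i) ?_
    simpa using (h i j).congr fun n => ((hM n).isHermitian.apply i j).symm
  · refine ge_of_tendsto' (f := fun n => x.sum fun i xi ↦ x.sum fun j xj ↦ star xi * M n i j * xj)
      (x := atTop) ?_ fun n => (hM n).2 x
    refine tendsto_finsetSum _ fun i _ => tendsto_finsetSum _ fun j _ => ?_
    exact ((h i j).const_mul _).mul_const _

theorem posSemidef_of_inner {ι : Type*} (v : ι → E) :
    (Matrix.of fun i j => ⟪v i, v j⟫_ℝ).PosSemidef := by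
  refine ⟨Matrix.IsHermitian.ext fun i j => by simp [real_inner_comm], fun x => ?_⟩
  have h : 0 ≤ ⟪x.sum fun i c => c • v i, x.sum fun i c => c • v i⟫_ℝ := real_inner_self_nonneg
  simp only [Finsupp.sum, sum_inner, inner_sum, real_inner_smul_left, real_inner_smul_right] at h
  rw [Finset.sum_comm] at h
  simpa [Finsupp.sum, mul_comm, mul_left_comm] using h

/-- The induction step is the Schur product theorem. -/
theorem posSemidef_inner_pow (n : ℕ) :
    (Matrix.of fun x y : E => ⟪x, y⟫_ℝ ^ n).PosSemidef := by
  induction n with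
  | zero =>
    have h : (Matrix.of fun x y : E => ⟪x, y⟫_ℝ ^ 0) = .of fun _ _ : E => ⟪(1 : ℝ), (1 : ℝ)⟫_ℝ := by
      ext x y
      simp
    exact h ▸ posSemidef_of_inner fun _ : E => (1 : ℝ)
  | succ n ih => exact ih.hadamard (posSemidef_of_inner fun x : E => x)

theorem posSemidef_exp_inner :
    (Matrix.of fun x y : E => Real.exp ⟪x, y⟫_ℝ).PosSemidef := by
  refine Matrix.PosSemidef.of_tendsto (M := fun n => ∑ k ∈ Finset.range n,
    (k.factorial : ℝ)⁻¹ • Matrix.of fun x y : E => ⟪x, y⟫_ℝ ^ k) (fun n => ?_) fun x y => ?_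
  · exact Matrix.posSemidef_sum _ fun k _ => (posSemidef_inner_pow k).smul (by positivity)
  · have := (NormedSpace.expSeries_div_hasSum_exp ⟪x, y⟫_ℝ).tendsto_sum_nat
    simpa [Matrix.sum_apply, div_eq_inv_mul, Real.exp_eq_exp_ℝ] using this

/-- The Gaussian kernel `exp (-‖x - y‖² / 2)`. -/
noncomputable def gaussianKernel {E : Type*} [NormedAddCommGroup E] (x y : E) : ℝ :=
  Real.exp (-(‖x - y‖ ^ 2 / 2))

/-- The Gaussian kernel is the product of `exp ⟪x, y⟫` and the rank one kernel
`exp (-‖x‖² / 2) * exp (-‖y‖² / 2)`. -/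
theorem posSemidef_gaussianKernel : (Matrix.of fun x y : E => gaussianKernel x y).PosSemidef := by
  have h : (Matrix.of fun x y : E => gaussianKernel x y) =
      (Matrix.of fun x y : E => Real.exp ⟪x, y⟫_ℝ) ⊙
        .of fun x y : E => ⟪Real.exp (-(‖x‖ ^ 2 / 2)), Real.exp (-(‖y‖ ^ 2 / 2))⟫_ℝ := by
    ext x y
    simp only [Matrix.of_apply, Matrix.hadamard_apply, gaussianKernel, RCLike.inner_apply,
      conj_trivial, ← Real.exp_add, norm_sub_sq_real]
    ring_nf
  rw [h]
  exact posSemidef_exp_inner.hadamard (posSemidef_of_inner _)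

/-- The Gaussian kernel with its values regarded as operators on `ℂ`, the form in which `RKHS` takes
a kernel. -/
noncomputable def gaussianKernelCLM (E : Type*) [NormedAddCommGroup E] [InnerProductSpace ℝ E] :
    Matrix E E (ℂ →L[ℂ] ℂ) :=
  .of fun x y => (gaussianKernel x y : ℂ) • (1 : ℂ →L[ℂ] ℂ)

theorem gaussianKernel_comm {E : Type*} [NormedAddCommGroup E] (x y : E) :
    gaussianKernel x y = gaussianKernel y x := by
  rw [gaussianKernel, gaussianKernel, norm_sub_rev]

theorem gaussianKernelCLM_apply (x y : E) (z : ℂ) :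
    gaussianKernelCLM E x y z = gaussianKernel x y * z := rfl

theorem posSemidef_gaussianKernelCLM : (gaussianKernelCLM E).PosSemidef := by
  have htfae := (RKHS.posSemidef_tfae (K := gaussianKernelCLM E)).out 0 2
  refine htfae.2 ⟨Matrix.IsHermitian.ext fun x y => ?_, fun f => ?_⟩
  · simp [gaussianKernelCLM, gaussianKernel_comm y x, -Complex.coe_smul]
  · -- The real and the imaginary part of the coefficients contribute separately.
    have key (p : ℂ → ℝ) (hp : p 0 = 0) :
        0 ≤ f.sum fun x z => f.sum fun y w => p z * gaussianKernel x y * p w := by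
      have h := (posSemidef_gaussianKernel (E := E)).2 (f.mapRange p hp)
      rw [Finsupp.sum_mapRange_index fun _ => by simp] at h
      refine h.trans_eq (Finsupp.sum_congr fun x _ => ?_)
      rw [Finsupp.sum_mapRange_index fun _ => by simp]
      rfl
    refine (add_nonneg (key Complex.re rfl) (key Complex.im rfl)).trans_eq ?_
    simp only [Finsupp.sum, ← Finset.sum_add_distrib, map_sum]
    refine Finset.sum_congr rfl fun x _ => Finset.sum_congr rfl fun y _ => ?_
    rw [gaussianKernelCLM_apply, gaussianKernel_comm y x]
    simp
    ring

end Kernel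

/-! ### Separable infinite-dimensional Hilbert spaces -/

/-- Distinct basis vectors have distance `√2`, so the balls of radius `1 / 2` around them are
disjoint. -/
theorem HilbertBasis.countable {ι K : Type*} [NormedAddCommGroup K] [InnerProductSpace ℂ K]
    [TopologicalSpace.SeparableSpace K] (b : HilbertBasis ι ℂ K) : Countable ι := by
  have hdist {i j : ι} (h : i ≠ j) : 1 < dist (b i) (b j) := by
    have h1 : ‖b i - b j‖ ^ 2 = 2 := by
      rw [norm_sub_sq (𝕜 := ℂ), b.orthonormal.1 i, b.orthonormal.1 j, b.orthonormal.2 h]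
      norm_num
    rw [dist_eq_norm]
    nlinarith [norm_nonneg (b i - b j)]
  have hd : (univ : Set ι).PairwiseDisjoint fun i => Metric.ball (b i) (1 / 2) :=
    fun i _ j _ h => Metric.ball_disjoint_ball (by linarith [hdist h])
  exact countable_univ_iff.1 <| hd.countable_of_isOpen (fun _ _ => Metric.isOpen_ball)
    fun i _ => ⟨b i, Metric.mem_ball_self (by norm_num)⟩

theorem nonempty_linearIsometryEquiv_hilbertEllTwo (K : Type*) [NormedAddCommGroup K]
    [InnerProductSpace ℂ K] [CompleteSpace K] [TopologicalSpace.SeparableSpace K]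
    (hK : ¬ FiniteDimensional ℂ K) : Nonempty (K ≃ₗᵢ[ℂ] HilbertEllTwo) := by
  obtain ⟨w, b, -⟩ := exists_hilbertBasis ℂ K
  have := b.countable
  have : Infinite w := not_finite_iff_infinite.1 fun h => hK <| by
    have := Fintype.ofFinite w
    exact b.toOrthonormalBasis.toBasis.finiteDimensional_of_finite
  obtain ⟨_⟩ := nonempty_denumerable w
  let σ := (Denumerable.eqv w).symm
  refine ⟨(HilbertBasis.mk (b.orthonormal.comp σ σ.injective) ?_).repr⟩
  rw [EquivLike.range_comp]
  exact b.dense_span.ge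

/-! ### The representation of a Hilbert space by Gaussian translations -/

/-- There are vectors `e x` of a complex Hilbert space, indexed by `x : E`, with dense span and with
Gram matrix the Gaussian kernel. -/
theorem exists_gaussianFeature (E : Type u) [NormedAddCommGroup E] [InnerProductSpace ℝ E] :
    ∃ (K : Type u) (_ : NormedAddCommGroup K) (_ : InnerProductSpace ℂ K) (_ : CompleteSpace K)
      (e : E → K), (∀ x y, ⟪e x, e y⟫_ℂ = gaussianKernel x y) ∧
        Dense (Submodule.span ℂ (range e) : Set K) := by
  have : Fact (gaussianKernelCLM E).PosSemidef := ⟨posSemidef_gaussianKernelCLM⟩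
  refine ⟨RKHS.OfKernel (gaussianKernelCLM E), inferInstance, inferInstance, inferInstance,
    fun x => RKHS.kerFun _ x 1, fun x y => ?_, ?_⟩
  · rw [← RKHS.kernel_inner, RKHS.OfKernel.kernel_ofKernel]
    simp [gaussianKernelCLM, gaussianKernel_comm y x]
  · rw [Submodule.dense_iff_topologicalClosure_eq_top, eq_top_iff,
      ← RKHS.kerFun_dense (RKHS.OfKernel (gaussianKernelCLM E))]
    refine Submodule.topologicalClosure_mono (Submodule.span_le.2 ?_)
    rintro _ ⟨x, v, rfl⟩
    rw [← mul_one v, ← smul_eq_mul, map_smul]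
    exact Submodule.smul_mem _ _ (Submodule.subset_span ⟨x, rfl⟩)

section Feature

variable {E : Type*} [NormedAddCommGroup E]
  {K : Type*} [NormedAddCommGroup K] [InnerProductSpace ℂ K] {e : E → K}

theorem dist_gaussianFeature (he : ∀ x y, ⟪e x, e y⟫_ℂ = gaussianKernel x y) (x y : E) :
    dist (e x) (e y) = √(2 - 2 * Real.exp (-(dist x y ^ 2 / 2))) := by
  have h1 (z : E) : ‖e z‖ ^ 2 = 1 := by
    rw [← inner_self_eq_norm_sq (𝕜 := ℂ), he]
    simp [gaussianKernel]
  rw [dist_eq_norm, ← Real.sqrt_sq (norm_nonneg _), norm_sub_sq (𝕜 := ℂ), h1, h1, he,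
    gaussianKernel, ← dist_eq_norm]
  congr 1
  simp only [RCLike.re_to_complex, Complex.ofReal_re]
  ring

theorem isUniformInducing_gaussianFeature (he : ∀ x y, ⟪e x, e y⟫_ℂ = gaussianKernel x y) :
    IsUniformInducing e := by
  refine Metric.isUniformInducing_iff.2 ⟨Metric.uniformContinuous_iff.2 fun ε hε => ?_,
    fun δ hδ => ?_⟩
  · have hc : Continuous fun t : ℝ => √(2 - 2 * Real.exp (-(t ^ 2 / 2))) := by fun_prop
    obtain ⟨δ, hδ, h⟩ := Metric.continuous_iff.1 hc 0 ε hε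
    refine ⟨δ, hδ, fun {x y} hxy => ?_⟩
    have := h (dist x y) (by simpa using hxy)
    rw [dist_gaussianFeature he]
    simpa using (le_abs_self _).trans_lt this
  · refine ⟨√(2 - 2 * Real.exp (-(δ ^ 2 / 2))), Real.sqrt_pos.2 ?_, fun {x y} hxy => ?_⟩
    · have : Real.exp (-(δ ^ 2 / 2)) < 1 := by
        rw [← Real.exp_zero]
        exact Real.exp_lt_exp.2 (neg_lt_zero.2 (by positivity))
      linarith
    · by_contra! hle
      rw [dist_gaussianFeature he] at hxy
      refine hxy.not_ge (Real.sqrt_le_sqrt ?_)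
      gcongr

theorem separableSpace_of_gaussianFeature [TopologicalSpace.SeparableSpace E]
    (he : ∀ x y, ⟪e x, e y⟫_ℂ = gaussianKernel x y)
    (hd : Dense (Submodule.span ℂ (range e) : Set K)) : TopologicalSpace.SeparableSpace K := by
  have h := (TopologicalSpace.isSeparable_range
    (isUniformInducing_gaussianFeature he).uniformContinuous.continuous).span (R := ℂ)
  rw [← TopologicalSpace.isSeparable_univ_iff, ← hd.closure_eq]
  exact h.closure

/-- The unit vectors `e (n • v)`, for a unit vector `v`, have no convergent subsequence. -/
theorem not_finiteDimensional_of_gaussianFeature [NormedSpace ℝ E] [Nontrivial E]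
    (he : ∀ x y, ⟪e x, e y⟫_ℂ = gaussianKernel x y) : ¬ FiniteDimensional ℂ K := by
  intro _
  have : ProperSpace K := FiniteDimensional.proper ℂ K
  obtain ⟨v, hv⟩ := exists_norm_eq E (zero_le_one' ℝ)
  let x : ℕ → E := fun n => (n : ℝ) • v
  have hb (n : ℕ) : e (x n) ∈ Metric.closedBall (0 : K) 1 := by
    have : ‖e (x n)‖ ^ 2 = 1 := by
      rw [← inner_self_eq_norm_sq (𝕜 := ℂ), he]
      simp [gaussianKernel]
    rw [mem_closedBall_zero_iff]
    nlinarith [norm_nonneg (e (x n))]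
  obtain ⟨a, -, φ, hφ, ha⟩ := (isCompact_closedBall (0 : K) 1).tendsto_subseq hb
  have hc : CauchySeq (x ∘ φ) := by
    have h : Cauchy (map e (map (x ∘ φ) atTop)) := ha.cauchySeq
    exact (isUniformInducing_gaussianFeature he).cauchy_map_iff.1 h
  obtain ⟨N, hN⟩ := Metric.cauchySeq_iff'.1 hc 1 one_pos
  have h1 := hN (N + 1) (Nat.le_succ N)
  have h2 : φ N + 1 ≤ φ (N + 1) := hφ (Nat.lt_succ_self N)
  have h3 : (φ N : ℝ) + 1 ≤ φ (N + 1) := by exact_mod_cast h2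
  rw [dist_eq_norm] at h1
  simp only [Function.comp, x, ← sub_smul, norm_smul, hv, mul_one, Real.norm_eq_abs] at h1
  linarith [le_abs_self ((φ (N + 1) : ℝ) - φ N)]

variable [CompleteSpace K]

/-- Translation by `y` preserves the Gram matrix of the vectors `e x`, so it is implemented by a
unitary operator. -/
theorem exists_translation (he : ∀ x y, ⟪e x, e y⟫_ℂ = gaussianKernel x y)
    (hd : Dense (Submodule.span ℂ (range e) : Set K)) (y : E) :
    ∃ U : K ≃ₗᵢ[ℂ] K, ∀ x, U (e x) = e (x + y) := by
  let T : (E →₀ ℂ) →ₗ[ℂ] K := Finsupp.linearCombination ℂ e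
  have hT : DenseRange T := by
    rwa [DenseRange, ← LinearMap.coe_range, Finsupp.range_linearCombination]
  let s : (E →₀ ℂ) ≃ₗ[ℂ] (E →₀ ℂ) := Finsupp.domLCongr (Equiv.addRight y)
  have hs (f : E →₀ ℂ) : T (s f) = Finsupp.linearCombination ℂ (fun x => e (x + y)) f := by
    simp [T, s, Finsupp.linearCombination_equivMapDomain, Function.comp_def]
  have hnorm (f : E →₀ ℂ) : ‖T (s f)‖ = ‖T f‖ := by
    rw [← sq_eq_sq₀ (norm_nonneg _) (norm_nonneg _), hs, ← inner_self_eq_norm_sq (𝕜 := ℂ),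
      ← inner_self_eq_norm_sq (𝕜 := ℂ)]
    simp only [T, Finsupp.linearCombination_apply, Finsupp.sum, sum_inner, inner_sum,
      inner_smul_left, inner_smul_right, he, gaussianKernel, add_sub_add_right_eq_sub]
  refine ⟨s.extendOfIsometry T T hT hT hnorm, fun x => ?_⟩
  have := LinearEquiv.extendOfIsometry_eq s T T hT hT hnorm (Finsupp.single x 1)
  simpa [hs, T] using this

/-- The unitary operators implementing the translations form a strongly continuous representation. -/
theorem exists_translationHom (he : ∀ x y, ⟪e x, e y⟫_ℂ = gaussianKernel x y)
    (hd : Dense (Submodule.span ℂ (range e) : Set K)) :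
    ∃ U : Multiplicative E →* (K ≃ₗᵢ[ℂ] K), (∀ y x, U y (e x) = e (x + y.toAdd)) ∧
      ∀ k, Continuous fun y => U y k := by
  choose U hU using exists_translation he hd
  have hmul (y z : E) : U (y + z) = U y * U z := by
    ext k
    refine DFunLike.congr_fun (f := (U (y + z)).toContinuousLinearEquiv.toContinuousLinearMap)
      (g := (U y * U z).toContinuousLinearEquiv.toContinuousLinearMap)
      (ContinuousLinearMap.ext_on hd ?_) k
    rintro _ ⟨x, rfl⟩
    simp [hU, add_assoc, add_comm z y]
  have hcont : Continuous e := (isUniformInducing_gaussianFeature he).uniformContinuous.continuous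
  refine ⟨MonoidHom.mk' (fun y => U y.toAdd) fun y z => hmul _ _, fun y x => hU _ _, fun k => ?_⟩
  change Continuous fun y : Multiplicative E => U y.toAdd k
  refine Continuous.comp (g := fun y : E => U y k) ?_ continuous_toAdd
  have hspan : ∀ s ∈ Submodule.span ℂ (range e), Continuous fun y => U y s := by
    intro s hs
    induction hs using Submodule.span_induction with
    | mem _ h =>
      obtain ⟨x, rfl⟩ := h
      simp only [hU]
      fun_prop
    | zero => simpa using continuous_const
    | add _ _ _ _ h1 h2 => simp only [map_add]; exact h1.add h2
    | smul c _ _ h => simp only [map_smul]; exact h.const_smul c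
  -- Isometries are equicontinuous, so continuity passes from the dense span to all vectors.
  refine continuous_of_uniform_approx_of_continuous fun V hV => ?_
  obtain ⟨ε, hε, hV⟩ := Metric.mem_uniformity_dist.1 hV
  obtain ⟨s, hs, hks⟩ := Metric.dense_iff.1 hd k ε hε
  refine ⟨_, hspan s hks, fun y => hV ?_⟩
  rw [LinearIsometryEquiv.dist_map, dist_comm]
  exact hs

end Feature

/-- The additive group of a nonzero separable real Hilbert space is isomorphic, as a topological
group, to a closed subgroup of the full unitary group. The orbit map of the vector `e 0` is
`y ↦ e y`, which is a uniform embedding; so convergence of the operators along a filter makes the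
filter Cauchy in `E`, and completeness of `E` gives that the image is closed. -/
theorem FullUnitaryGroup.exists_isClosedEmbedding (E : Type*) [NormedAddCommGroup E]
    [InnerProductSpace ℝ E] [CompleteSpace E] [TopologicalSpace.SeparableSpace E] [Nontrivial E] :
    ∃ Φ : Multiplicative E →* FullUnitaryGroup, IsClosedEmbedding Φ := by
  obtain ⟨K, _, _, _, e, he, hd⟩ := exists_gaussianFeature E
  have hui := isUniformInducing_gaussianFeature he
  have := separableSpace_of_gaussianFeature he hd
  obtain ⟨R⟩ := nonempty_linearIsometryEquiv_hilbertEllTwo K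
    (not_finiteDimensional_of_gaussianFeature he)
  obtain ⟨U, hU, hUc⟩ := exists_translationHom he hd
  let Φ : Multiplicative E →* FullUnitaryGroup :=
    { toFun := fun y => (R.symm.trans (U y)).trans R
      map_one' := LinearIsometryEquiv.ext fun x => by simp; rfl
      map_mul' := fun y z => LinearIsometryEquiv.ext fun x => by
        change R (U (y * z) (R.symm x)) = R (U y (R.symm (R (U z (R.symm x)))))
        simp }
  have hΦ (y : Multiplicative E) (x : HilbertEllTwo) : (Φ y).toFun x = R (U y (R.symm x)) := rfl
  have hc : Continuous Φ := FullUnitaryGroup.continuous_iff.2 fun x => by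
    simp only [hΦ]
    exact R.continuous.comp (hUc _)
  have hev (y : Multiplicative E) : (Φ y).toFun (R (e 0)) = R (e y.toAdd) := by simp [hΦ, hU]
  have hRe : IsUniformInducing (R ∘ e) := R.isometry.isUniformInducing.comp hui
  have hind : IsInducing Φ := by
    refine IsInducing.of_comp hc (FullUnitaryGroup.continuous_toFun (R (e 0))) ?_
    have : (fun u : FullUnitaryGroup => u.toFun (R (e 0))) ∘ Φ = (R ∘ e) ∘ Multiplicative.toAdd :=
      funext hev
    rw [this]
    exact hRe.isInducing.comp (Homeomorph.refl E).isInducing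
  have : T0Space (Multiplicative E) := inferInstanceAs (T0Space E)
  refine ⟨Φ, ⟨hind, hind.injective⟩, isClosed_of_closure_subset fun u hu => ?_⟩
  have hne : (comap Φ (𝓝 u)).NeBot := comap_neBot_iff.2 fun t ht => by
    obtain ⟨_, hx, y, rfl⟩ := mem_closure_iff_nhds.1 hu t ht
    exact ⟨y, hx⟩
  have hlim (x : HilbertEllTwo) :
      Tendsto (fun y => (Φ y).toFun x) (comap Φ (𝓝 u)) (𝓝 (u.toFun x)) :=
    ((FullUnitaryGroup.continuous_toFun x).tendsto u).comp tendsto_comap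
  have hcauchy : Cauchy (map Multiplicative.toAdd (comap Φ (𝓝 u))) := by
    refine hRe.cauchy_map_iff.1 ((cauchy_nhds (a := u.toFun (R (e 0)))).mono ?_)
    exact (hlim (R (e 0))).congr hev
  obtain ⟨y, hy⟩ := CompleteSpace.complete hcauchy
  refine ⟨Multiplicative.ofAdd y, LinearIsometryEquiv.ext fun x => ?_⟩
  refine tendsto_nhds_unique ?_ (hlim x)
  have hcx := (FullUnitaryGroup.continuous_toFun x).comp hc
  exact (hcx.tendsto (Multiplicative.ofAdd y)).mono_left hy

/-! ### Abelian Polish groups as quotients -/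

/-- The first isomorphism theorem, transported along a closed embedding of the source. -/
theorem exists_closed_subgroup_quotient_of_isOpenQuotientMap {P Q G : Type*} [CommGroup P]
    [TopologicalSpace P] [Group Q] [TopologicalSpace Q] [Group G] [TopologicalSpace G] [T1Space G]
    {Φ : P →* Q} (hΦ : IsClosedEmbedding Φ) {q : P →* G} (hq : IsOpenQuotientMap q) :
    ∃ H : Subgroup Q, IsClosed (H : Set Q) ∧ (∀ a ∈ H, ∀ b ∈ H, a * b = b * a) ∧
      ∃ (N : Subgroup H) (_ : N.Normal), IsClosed (N : Set H) ∧ Nonempty (G ≃ₜ* (H ⧸ N)) := by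
  let ε : P ≃* Φ.range := MonoidHom.ofInjective hΦ.injective
  let h : Φ.range ≃ₜ P :=
    { toEquiv := ε.symm.toEquiv
      continuous_toFun := hΦ.isInducing.continuous_iff.2 <| continuous_subtype_val.congr fun x =>
        (MonoidHom.apply_ofInjective_symm hΦ.injective x).symm
      continuous_invFun := hΦ.continuous.subtype_mk _ }
  let f : Φ.range →* G := q.comp ε.symm.toMonoidHom
  have hf : IsOpenQuotientMap f := hq.comp h.isOpenQuotientMap
  let e : Φ.range ⧸ f.ker ≃* G := QuotientGroup.quotientKerEquivOfSurjective f hf.surjective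
  have he : IsOpenQuotientMap (e ∘ ((↑) : Φ.range → Φ.range ⧸ f.ker)) := hf
  have hcont : Continuous e := continuous_quot_lift _ hf.continuous
  refine ⟨Φ.range, hΦ.isClosed_range, ?_, f.ker, inferInstance,
    isClosed_singleton.preimage hf.continuous, ⟨(?_ : Φ.range ⧸ f.ker ≃ₜ* G).symm⟩⟩
  · rintro _ ⟨a, rfl⟩ _ ⟨b, rfl⟩
    rw [← map_mul, mul_comm, map_mul]
  · exact
      { e with
        continuous_toFun := hcont
        continuous_invFun := he.isQuotientMap.continuous_iff.2 <|
          continuous_quot_mk.congr fun x => (e.symm_apply_apply _).symm }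

theorem separableSpace_ellTwo (ι : Type*) [Countable ι] :
    TopologicalSpace.SeparableSpace (lp (fun _ : ι => ℝ) 2) := by
  let b : HilbertBasis ι ℝ (lp (fun _ : ι => ℝ) 2) := ⟨LinearIsometryEquiv.refl ℝ _⟩
  have h := ((countable_range b).isSeparable.span (R := ℝ)).closure
  rw [← TopologicalSpace.isSeparable_univ_iff]
  rwa [← Submodule.topologicalClosure_coe, b.dense_span] at h

/-- Every abelian Polish group is the image of a closed additive subgroup of a separable real Hilbert
space under a continuous open homomorphism. -/
theorem exists_closed_addSubgroup_isOpenQuotientMap (A : Type u) [AddCommGroup A]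
    [TopologicalSpace A] [IsTopologicalAddGroup A] [PolishSpace A] :
    ∃ (ι : Type u) (_ : Countable ι) (_ : Nonempty ι) (L : AddSubgroup (lp (fun _ : ι => ℝ) 2))
      (q : L →+ A), IsClosed (L : Set (lp (fun _ : ι => ℝ) 2)) ∧ IsOpenQuotientMap q := by
  obtain ⟨N, rfl, hN⟩ := exists_complete_addGroupNorm A
  let _ := N.toNormedAddCommGroup
  let f : (ℕ →₀ ℤ) →+ A := (Finsupp.linearCombination ℤ (TopologicalSpace.denseSeq A)).toAddMonoidHom
  let D : AddSubgroup A := f.range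
  have hD : Dense (D : Set A) := (TopologicalSpace.denseRange_denseSeq A).mono <| by
    rintro _ ⟨n, rfl⟩
    exact ⟨Finsupp.single n 1, by simp [f]⟩
  have : Countable D := (countable_range f).to_subtype
  exact ⟨D, this, inferInstance, weightedLattice D, weightedLattice.eval D,
    weightedLattice.isClosed, weightedLattice.isOpenQuotientMap_eval hD⟩

theorem mainTheorem3 {G : Type*} [CommGroup G] [TopologicalSpace G] [IsTopologicalGroup G]
    [PolishSpace G] :
    ∃ H : Subgroup FullUnitaryGroup,
      IsClosed (H : Set FullUnitaryGroup) ∧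
      (∀ a ∈ H, ∀ b ∈ H, a * b = b * a) ∧
      ∃ (N : Subgroup H) (_ : N.Normal),
        IsClosed (N : Set H) ∧ Nonempty (G ≃ₜ* (H ⧸ N)) := by
  have : PolishSpace (Additive G) := ‹PolishSpace G›
  obtain ⟨ι, _, _, L, q, hL, hq⟩ := exists_closed_addSubgroup_isOpenQuotientMap (Additive G)
  have := separableSpace_ellTwo ι
  have : Nontrivial (lp (fun _ : ι => ℝ) 2) := by
    classical
    obtain ⟨i⟩ := ‹Nonempty ι›
    refine ⟨lp.single 2 i 1, 0, fun h => ?_⟩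
    simpa using congrArg (fun f : lp (fun _ : ι => ℝ) 2 => f i) h
  obtain ⟨Φ, hΦ⟩ := FullUnitaryGroup.exists_isClosedEmbedding (lp (fun _ : ι => ℝ) 2)
  exact exists_closed_subgroup_quotient_of_isOpenQuotientMap
    (Φ := Φ.comp (AddMonoidHom.toMultiplicative L.subtype)) (hΦ.comp hL.isClosedEmbedding_subtypeVal)
    (q := AddMonoidHom.toMultiplicativeLeft q) hq
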